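/- Let $\mathbb P=\{1,2,3,\dots\}$ and let $\mathbb P^*$ be the set of all finite words over $\mathbb P$, including the empty word. Knuth equivalence $\equiv$ is the equivalence relation on $\mathbb P^*$ generated by $xacby\equiv xcaby$ for $a\le b<c$ and $xbacy\equiv xbcay$ for $a<b\le c$, where $x,y\in\mathbb P^*$ and $a,b,c\in\mathbb P$. For $u\in\mathbb P^*$ let $C(u)=\{w\in\mathbb P^* : uw\equiv wu\}$, where $uw$ denotes concatenation. For $w\in\mathbb P^*$ let $P(w)$ be the insertion tableau of $w$ under the Robinson--Schensted--Knuth correspondence, that is, the semistandard Young tableau obtained from the empty tableau by row-inserting the letters of $w$ from left to right. Its columns are the columns of its (left-justified) shape, so all of them are nonempty. A singleton $2$-column is a column of length $1$ whose only entry is $2$. Theorem. For every $w\in\mathbb P^*$, we have $w\in C(212)$, where $212$ is the word of length three with letters $2,1,2$, if and only if all columns $C$ of $P(w)$ satisfy the following two conditions: (a) if $C$ has length $1$, then $C$ is a singleton $2$-column; (b) if $C$ has length at least $2$, then $C$ contains both $1$ and $2$. -/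

import Mathlib

namespace Plactic

/-- Words over the positive integers. -/
abbrev Word : Type := List ℕ+

/-- `KnuthTransposition v w`: the words `v`, `w` differ by one elementary Knuth move, read from
left to right. The symmetric moves are added in `KnuthEquiv`. -/
inductive KnuthTransposition : Word → Word → Prop
  | acb_cab (x y : Word) (a b c : ℕ+) (hab : a ≤ b) (hbc : b < c) :
      KnuthTransposition (x ++ [a, c, b] ++ y) (x ++ [c, a, b] ++ y)
  | bac_bca (x y : Word) (a b c : ℕ+) (hab : a < b) (hbc : b ≤ c) :
      KnuthTransposition (x ++ [b, a, c] ++ y) (x ++ [b, c, a] ++ y)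

/-- Knuth equivalence: the equivalence relation generated by Knuth transpositions. -/
def KnuthEquiv : Word → Word → Prop := Relation.EqvGen KnuthTransposition

/-- The centralizer `C(u)`: all words `w` such that `uw` is Knuth-equivalent to `wu`. -/
def centralizer (u : Word) : Set Word := {w | KnuthEquiv (u ++ w) (w ++ u)}

/-- A tableau, as the list of its rows from top to bottom, each row read from left to right. -/
abbrev Tableau : Type := List (List ℕ+)

/-- Row insertion of `x`: replace the leftmost entry that is larger than `x` by `x` and return the
replaced entry, or append `x` at the end of the row if there is no such entry. -/
def rowInsert (x : ℕ+) : List ℕ+ → List ℕ+ × Option ℕ+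
  | [] => ([x], none)
  | y :: R => if x < y then (x :: R, some y) else (y :: (rowInsert x R).1, (rowInsert x R).2)

/-- Schensted insertion of an entry into a tableau: insert it into the first row, then insert the
entry bumped from each row into the next row, until no entry is bumped. -/
def insert : Tableau → ℕ+ → Tableau
  | [], x => [[x]]
  | R :: T, x =>
    match rowInsert x R with
    | (R', none) => R' :: T
    | (R', some y) => R' :: insert T y

/-- The insertion tableau `P(w)` of a word under the Robinson-Schensted-Knuth correspondence:
insert the letters of `w` from left to right, starting with the empty tableau. -/
def P (w : Word) : Tableau := w.foldl insert []

/-- The `j`-th column (counted from `0`), read from top to bottom. -/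
def column (T : Tableau) (j : ℕ) : List ℕ+ := T.filterMap fun R => R[j]?

/-- The list of all columns; there are as many as the first row has entries. -/
def columns (T : Tableau) : List (List ℕ+) :=
  (List.range (T.headD []).length).map (column T)

/-- A singleton `a`-column is a column of length `1` whose entry is `a`. -/
def IsSingletonColumn (a : ℕ+) (C : List ℕ+) : Prop := C = [a]

end Plactic

namespace Plactic

/-! ### Knuth equivalence is a congruence -/

namespace KnuthEquiv

/-! Membership in a centralizer depends only on the Knuth class, and `w` is Knuth-equivalent to the
row reading word of the semistandard tableau `P w` (`isSemistandard_P_and_equiv`).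

Sufficiency: the row word is equivalent to the product of the columns, each read downwards in value
(`rowWord_equiv_columns`). A strictly decreasing word commutes with each of its letters
(`KnuthEquiv.letter_column`), so a column containing `1` and `2` commutes with `212`; so does the
single letter `2`. Centralizers are closed under products.

Necessity rests on two Knuth invariants. Cancelling each `2` against a later `1` leaves `unmatched
w` ones; comparing `212w` with `w212` forces this number to be `0`. The maximal size `twoIncreasing
w 1 1` of a union of two weakly increasing subsequences grows by at least 3 under left
multiplication by `212`; under right multiplication it can grow that much only if it is at most the
number of letters `≤ 2` (`twoIncreasing_le_countP`). The first two rows are such a union and all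
lower entries are `≥ 3`, so the first two rows contain only `1` and `2`. Hence a column of length at
least 2 starts with `1, 2`, and a column of length 1 holding `1` would leave an unmatched `1`. -/

@[refl] theorem refl (v : Word) : KnuthEquiv v v := Relation.EqvGen.refl v

@[symm] theorem symm {v w : Word} (h : KnuthEquiv v w) : KnuthEquiv w v :=
  Relation.EqvGen.symm _ _ h

@[trans] theorem trans {u v w : Word} (h : KnuthEquiv u v) (h' : KnuthEquiv v w) :
    KnuthEquiv u w := Relation.EqvGen.trans _ _ _ h h'

instance : Trans KnuthEquiv KnuthEquiv KnuthEquiv := ⟨trans⟩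

theorem append_left (x : Word) {v w : Word} (h : KnuthEquiv v w) :
    KnuthEquiv (x ++ v) (x ++ w) := by
  induction h with
  | rel v w h =>
    apply Relation.EqvGen.rel
    cases h with
    | acb_cab y z a b c hab hbc =>
      simpa using KnuthTransposition.acb_cab (x ++ y) z a b c hab hbc
    | bac_bca y z a b c hab hbc =>
      simpa using KnuthTransposition.bac_bca (x ++ y) z a b c hab hbc
  | refl v => exact refl _
  | symm v w _ ih => exact ih.symm
  | trans u v w _ _ ih ih' => exact ih.trans ih'

theorem append_right (y : Word) {v w : Word} (h : KnuthEquiv v w) :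
    KnuthEquiv (v ++ y) (w ++ y) := by
  induction h with
  | rel v w h =>
    apply Relation.EqvGen.rel
    cases h with
    | acb_cab x z a b c hab hbc =>
      simpa using KnuthTransposition.acb_cab x (z ++ y) a b c hab hbc
    | bac_bca x z a b c hab hbc =>
      simpa using KnuthTransposition.bac_bca x (z ++ y) a b c hab hbc
  | refl v => exact refl _
  | symm v w _ ih => exact ih.symm
  | trans u v w _ _ ih ih' => exact ih.trans ih'

theorem cons (a : ℕ+) {v w : Word} (h : KnuthEquiv v w) : KnuthEquiv (a :: v) (a :: w) :=
  append_left [a] h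

theorem acb_cab {a b c : ℕ+} (y : Word) (hab : a ≤ b) (hbc : b < c) :
    KnuthEquiv (a :: c :: b :: y) (c :: a :: b :: y) :=
  Relation.EqvGen.rel _ _ (KnuthTransposition.acb_cab [] y a b c hab hbc)

theorem bac_bca {a b c : ℕ+} (y : Word) (hab : a < b) (hbc : b ≤ c) :
    KnuthEquiv (b :: a :: c :: y) (b :: c :: a :: y) :=
  Relation.EqvGen.rel _ _ (KnuthTransposition.bac_bca [] y a b c hab hbc)

/-- A function of words that is compatible with left multiplication by letters and with the two
Knuth moves at the start of a word is invariant under Knuth equivalence. -/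
theorem invariant {α : Type*} (f : Word → α)
    (hcons : ∀ x v w, f v = f w → f (x :: v) = f (x :: w))
    (h₁ : ∀ a b c y, a ≤ b → b < c → f (a :: c :: b :: y) = f (c :: a :: b :: y))
    (h₂ : ∀ a b c y, a < b → b ≤ c → f (b :: a :: c :: y) = f (b :: c :: a :: y))
    {v w : Word} (h : KnuthEquiv v w) : f v = f w := by
  have key : ∀ x v w : Word, f v = f w → f (x ++ v) = f (x ++ w) := by
    intro x v w hvw
    induction x with
    | nil => exact hvw
    | cons a x ih => exact hcons _ _ _ ih
  induction h with
  | rel v w h =>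
    cases h with
    | acb_cab x y a b c hab hbc =>
      simpa using key x _ _ (h₁ a b c y hab hbc)
    | bac_bca x y a b c hab hbc =>
      simpa using key x _ _ (h₂ a b c y hab hbc)
  | refl v => rfl
  | symm v w _ ih => exact ih.symm
  | trans u v w _ _ ih ih' => exact ih.trans ih'

/-- A letter smaller than all letters of a row moves left past all entries but the first. -/
theorem row_letter {e d : ℕ+} {s : Word} (hs : (e :: s).Pairwise (· ≤ ·)) (hd : d < e) (y : Word) :
    KnuthEquiv (e :: (s ++ d :: y)) (e :: d :: (s ++ y)) := by
  induction s generalizing e with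
  | nil => exact refl _
  | cons t s ih =>
    have hs' := List.pairwise_cons.1 hs
    have het : e ≤ t := hs'.1 t (by simp)
    calc KnuthEquiv (e :: t :: (s ++ d :: y)) (e :: t :: d :: (s ++ y)) :=
          (ih hs'.2 (hd.trans_le het)).cons e
      KnuthEquiv _ (e :: d :: t :: (s ++ y)) := (bac_bca _ hd het).symm

/-- The letters of `D` cross `s` one at a time by `row_letter`; each one that has crossed replaces
`e` as the pivot for the next, smaller one. -/
theorem row_column {e : ℕ+} {s D : Word} (hs : (e :: s).Pairwise (· ≤ ·))
    (hD : (e :: D).Pairwise (· > ·)) :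
    KnuthEquiv (e :: (s ++ D)) (e :: (D ++ s)) := by
  induction D generalizing e with
  | nil => simpa using refl _
  | cons d D ih =>
    have hs' := List.pairwise_cons.1 hs
    have hD' := List.pairwise_cons.1 hD
    have hde : d < e := hD'.1 d (by simp)
    refine (row_letter hs hde D).trans ((ih ?_ hD'.2).cons e)
    exact List.pairwise_cons.2 ⟨fun t ht => hde.le.trans (hs'.1 t ht), hs'.2⟩

theorem letter_column_of_le {b a : ℕ+} {D : Word} (hD : (b :: D).Pairwise (· > ·)) (hba : b ≤ a) :
    KnuthEquiv (b :: a :: D) (b :: (D ++ [a])) := by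
  induction D generalizing b with
  | nil => exact refl _
  | cons d D ih =>
    have hD' := List.pairwise_cons.1 hD
    have hdb : d < b := hD'.1 d (by simp)
    exact (bac_bca D hdb hba).symm.trans ((ih hD'.2 (hdb.le.trans hba)).cons b)

/-- A letter of a column commutes with the column. -/
theorem letter_column {a : ℕ+} {D : Word} (hD : D.Pairwise (· > ·)) (ha : a ∈ D) :
    KnuthEquiv (a :: D) (D ++ [a]) := by
  induction D with
  | nil => simp at ha
  | cons d D ih =>
    have hD' := List.pairwise_cons.1 hD
    rcases List.mem_cons.1 ha with rfl | ha'
    · exact letter_column_of_le hD le_rfl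
    · refine KnuthEquiv.trans ?_ ((ih hD'.2 ha').cons d)
      cases D with
      | nil => simp at ha'
      | cons t D =>
        have hat : a ≤ t := by
          rcases List.mem_cons.1 ha' with rfl | h
          · exact le_rfl
          · exact ((List.pairwise_cons.1 hD'.2).1 a h).le
        exact acb_cab D hat (hD'.1 t (by simp))

end KnuthEquiv

/-! ### Centralizers -/

theorem mem_centralizer_congr {u v w : Word} (h : KnuthEquiv v w) :
    v ∈ centralizer u ↔ w ∈ centralizer u := by
  constructor <;> intro hv
  · exact ((h.append_left u).symm.trans hv).trans (h.append_right u)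
  · exact ((h.append_left u).trans hv).trans (h.append_right u).symm

theorem nil_mem_centralizer (u : Word) : [] ∈ centralizer u := by
  simpa [centralizer] using KnuthEquiv.refl u

theorem append_mem_centralizer {u v w : Word} (hv : v ∈ centralizer u) (hw : w ∈ centralizer u) :
    v ++ w ∈ centralizer u := by
  have h₁ : KnuthEquiv (u ++ v ++ w) (v ++ u ++ w) := KnuthEquiv.append_right w hv
  have h₂ : KnuthEquiv (v ++ (u ++ w)) (v ++ (w ++ u)) := KnuthEquiv.append_left v hw
  simp only [centralizer, Set.mem_ofPred_eq, List.append_assoc] at *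
  exact h₁.trans h₂

theorem mem_centralizer_comm {u v : Word} : u ∈ centralizer v ↔ v ∈ centralizer u :=
  ⟨KnuthEquiv.symm, KnuthEquiv.symm⟩

theorem flatten_mem_centralizer {u : Word} {L : List Word} (h : ∀ v ∈ L, v ∈ centralizer u) :
    L.flatten ∈ centralizer u := by
  induction L with
  | nil => exact nil_mem_centralizer u
  | cons v L ih =>
    exact append_mem_centralizer (h v (by simp)) (ih fun v' hv' => h v' (by simp [hv']))

/-- Commuting is symmetric, so it is enough that each letter of `u` commutes with `D`. -/
theorem column_mem_centralizer {D u : Word} (hD : D.Pairwise (· > ·)) (hu : ∀ a ∈ u, a ∈ D) :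
    D ∈ centralizer u := by
  rw [mem_centralizer_comm]
  induction u with
  | nil => exact nil_mem_centralizer D
  | cons a u ih =>
    refine append_mem_centralizer (v := [a]) ?_ (ih fun b hb => hu b (by simp [hb]))
    exact (KnuthEquiv.letter_column hD (hu a (by simp))).symm

/-! ### Tableaux and their reading words -/

/-- `S` may stand below `R`: it is not longer, and its entries are larger than those above. -/
def Dominates : List ℕ+ → List ℕ+ → Prop
  | _, [] => True
  | [], _ :: _ => False
  | a :: R, b :: S => a < b ∧ Dominates R S

theorem Dominates.nil (R : List ℕ+) : Dominates R [] := by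
  cases R <;> trivial

theorem Dominates.getElem? {R S : List ℕ+} (h : Dominates R S) {j : ℕ} {b : ℕ+}
    (hb : S[j]? = some b) : ∃ a, R[j]? = some a ∧ a < b := by
  induction R generalizing S j with
  | nil => cases S <;> simp_all [Dominates]
  | cons r R ih =>
    cases S with
    | nil => simp at hb
    | cons s S =>
      cases j with
      | zero => simp only [List.getElem?_cons_zero, Option.some.injEq] at hb ⊢
                exact ⟨r, rfl, hb ▸ h.1⟩
      | succ j => simpa using ih h.2 (by simpa using hb)

theorem Dominates.exists_lt {R S : List ℕ+} (h : Dominates R S) {b : ℕ+} (hb : b ∈ S) :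
    ∃ a ∈ R, a < b := by
  obtain ⟨j, hj⟩ := List.getElem?_of_mem hb
  obtain ⟨a, ha, hab⟩ := h.getElem? hj
  exact ⟨a, List.mem_of_getElem? ha, hab⟩

theorem Dominates.length_le {R S : List ℕ+} (h : Dominates R S) : S.length ≤ R.length := by
  induction R generalizing S with
  | nil => cases S <;> simp_all [Dominates]
  | cons r R ih =>
    cases S with
    | nil => simp
    | cons s S => simpa using ih h.2

theorem Dominates.trans {R S U : List ℕ+} (h : Dominates R S) (h' : Dominates S U) :
    Dominates R U := by
  induction R generalizing S U with
  | nil => cases S <;> cases U <;> simp_all [Dominates]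
  | cons r R ih =>
    cases S <;> cases U <;> simp_all only [Dominates]
    exact ⟨h.1.trans h'.1, ih h.2 h'.2⟩

instance : IsTrans (List ℕ+) Dominates := ⟨fun _ _ _ => Dominates.trans⟩

/-- Semistandardness of a list of rows. -/
def IsSemistandard (T : Tableau) : Prop :=
  (∀ R ∈ T, R.Pairwise (· ≤ ·)) ∧ T.IsChain Dominates

/-- The row reading word: the rows from bottom to top. -/
def rowWord (T : Tableau) : Word := T.reverse.flatten

@[simp] theorem rowWord_nil : rowWord [] = [] := rfl

@[simp] theorem rowWord_cons (R : List ℕ+) (T : Tableau) : rowWord (R :: T) = rowWord T ++ R := by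
  simp [rowWord]

theorem mem_rowInsert {x z : ℕ+} {R : List ℕ+} (h : z ∈ (rowInsert x R).1) : z = x ∨ z ∈ R := by
  induction R with
  | nil => simpa [rowInsert] using h
  | cons r R ih =>
    simp only [rowInsert] at h
    split_ifs at h
    · simp at h ⊢; tauto
    · simp at h ⊢; tauto

theorem pairwise_rowInsert (x : ℕ+) {R : List ℕ+} (hR : R.Pairwise (· ≤ ·)) :
    (rowInsert x R).1.Pairwise (· ≤ ·) := by
  induction R with
  | nil => simp [rowInsert]
  | cons r R ih =>
    have hR' := List.pairwise_cons.1 hR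
    simp only [rowInsert]
    split_ifs with h
    · exact List.pairwise_cons.2 ⟨fun z hz => h.le.trans (hR'.1 z hz), hR'.2⟩
    · refine List.pairwise_cons.2 ⟨fun z hz => ?_, ih hR'.2⟩
      rcases mem_rowInsert hz with rfl | hz
      · exact not_lt.1 h
      · exact hR'.1 z hz

theorem lt_of_rowInsert {x y : ℕ+} {R : List ℕ+} (h : (rowInsert x R).2 = some y) : x < y := by
  induction R with
  | nil => simp [rowInsert] at h
  | cons r R ih =>
    simp only [rowInsert] at h
    split_ifs at h with hx
    · simp at h; exact h ▸ hx
    · exact ih h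

theorem rowInsert_of_none {x : ℕ+} {R : List ℕ+} (h : (rowInsert x R).2 = none) :
    (rowInsert x R).1 = R ++ [x] := by
  induction R with
  | nil => rfl
  | cons r R ih =>
    simp only [rowInsert] at h ⊢
    split_ifs at h ⊢ with hx
    simpa using ih h

theorem Dominates.rowInsert_left (x : ℕ+) {R S : List ℕ+} (h : Dominates R S) :
    Dominates (rowInsert x R).1 S := by
  induction R generalizing S with
  | nil => cases S <;> simp_all [Dominates]
  | cons r R ih =>
    cases S with
    | nil => simp [Dominates]
    | cons s S =>
      simp only [rowInsert]
      split_ifs with hx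
      · exact ⟨hx.trans h.1, h.2⟩
      · exact ⟨h.1, ih h.2⟩

/-- The entry below the bumped `y`, if any, exceeds `y`, so `y` enters the next row weakly to the
left of the column that it left. -/
theorem Dominates.rowInsert {x y : ℕ+} {R S : List ℕ+} (h : Dominates R S)
    (hy : (rowInsert x R).2 = some y) : Dominates (rowInsert x R).1 (rowInsert y S).1 := by
  induction R generalizing S with
  | nil => simp [Plactic.rowInsert] at hy
  | cons r R ih =>
    have hxy := lt_of_rowInsert hy
    simp only [Plactic.rowInsert] at hy ⊢
    split_ifs at hy ⊢ with hx
    · obtain rfl : r = y := by simpa using hy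
      cases S with
      | nil => exact ⟨hx, Dominates.nil R⟩
      | cons s S =>
        simp only [Plactic.rowInsert, if_pos h.1]
        exact ⟨hx, h.2⟩
    · have hry : r < y := (not_lt.1 hx).trans_lt hxy
      cases S with
      | nil => exact ⟨hry, Dominates.nil _⟩
      | cons s S =>
        simp only [Plactic.rowInsert]
        split_ifs with hs
        · exact ⟨hry, h.2.rowInsert_left x⟩
        · exact ⟨h.1, ih h.2 hy⟩

theorem insert_cons_none {x : ℕ+} {R : List ℕ+} (h : (rowInsert x R).2 = none) (T : Tableau) :
    insert (R :: T) x = (rowInsert x R).1 :: T := by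
  rcases hr : rowInsert x R with ⟨R', _ | y⟩ <;> simp_all [insert]

theorem insert_cons_some {x y : ℕ+} {R : List ℕ+} (h : (rowInsert x R).2 = some y)
    (T : Tableau) : insert (R :: T) x = (rowInsert x R).1 :: insert T y := by
  rcases hr : rowInsert x R with ⟨R', _ | y'⟩ <;> simp_all [insert]

theorem insert_head (T : Tableau) (x : ℕ+) :
    ∃ T', insert T x = (rowInsert x (T.headD [])).1 :: T' := by
  cases T with
  | nil => exact ⟨[], rfl⟩
  | cons R T =>
    cases h : (rowInsert x R).2 with
    | none => exact ⟨_, insert_cons_none h T⟩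
    | some y => exact ⟨_, insert_cons_some h T⟩

theorem dominates_headD {R : List ℕ+} {T : Tableau} (h : (R :: T).IsChain Dominates) :
    Dominates R (T.headD []) := by
  cases T with
  | nil => exact Dominates.nil R
  | cons S T => exact (List.isChain_cons_cons.1 h).1

theorem IsSemistandard.insert {T : Tableau} (h : IsSemistandard T) (x : ℕ+) :
    IsSemistandard (insert T x) := by
  induction T generalizing x with
  | nil => simp [IsSemistandard, Plactic.insert]
  | cons R T ih =>
    obtain ⟨hrow, hchain⟩ := h
    have hR : (rowInsert x R).1.Pairwise (· ≤ ·) := pairwise_rowInsert x (hrow R (by simp))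
    have hT : IsSemistandard T := ⟨fun S hS => hrow S (by simp [hS]), hchain.tail⟩
    cases hy : (rowInsert x R).2 with
    | none =>
      rw [insert_cons_none hy]
      refine ⟨by simpa using ⟨hR, hT.1⟩, ?_⟩
      cases T with
      | nil => simp
      | cons S T =>
        have := List.isChain_cons_cons.1 hchain
        exact List.isChain_cons_cons.2 ⟨this.1.rowInsert_left x, this.2⟩
    | some y =>
      rw [insert_cons_some hy]
      have hI := ih hT y
      refine ⟨by simpa using ⟨hR, hI.1⟩, ?_⟩
      obtain ⟨T', hT'⟩ := insert_head T y
      have hI2 := hI.2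
      rw [hT'] at hI2 ⊢
      exact List.isChain_cons_cons.2 ⟨(dominates_headD hchain).rowInsert hy, hI2⟩

theorem head_rowInsert {x y : ℕ+} {R : List ℕ+} (hR : R.Pairwise (· ≤ ·))
    (hy : (rowInsert x R).2 = some y) : ∃ h R', (rowInsert x R).1 = h :: R' ∧ h ≤ x := by
  cases R with
  | nil => simp [rowInsert] at hy
  | cons r R =>
    simp only [rowInsert]
    split_ifs with hx
    · exact ⟨_, _, rfl, le_rfl⟩
    · exact ⟨_, _, rfl, not_lt.1 hx⟩

/-- The inserted letter travels left to the entry `y` that it bumps, and `y` then travels left to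
the front of the row. -/
theorem KnuthEquiv.rowInsert {x y : ℕ+} {R : List ℕ+} (hR : R.Pairwise (· ≤ ·))
    (hy : (rowInsert x R).2 = some y) : KnuthEquiv (R ++ [x]) (y :: (rowInsert x R).1) := by
  induction R with
  | nil => simp [Plactic.rowInsert] at hy
  | cons r R ih =>
    have hR' := List.pairwise_cons.1 hR
    have hsort := pairwise_rowInsert x hR
    have hxy := lt_of_rowInsert hy
    simp only [Plactic.rowInsert] at hy hsort ⊢
    split_ifs at hy hsort ⊢ with hx
    · obtain rfl : r = y := by simpa using hy
      simpa using KnuthEquiv.row_letter hR hx []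
    · refine ((ih hR'.2 hy).cons r).trans ?_
      obtain ⟨h, R'', hh, hhx⟩ := head_rowInsert hR'.2 hy
      rw [hh] at hsort ⊢
      -- With `h` the head of the new tail, `r y h` becomes `y r h`, since `r ≤ h ≤ x < y`.
      exact KnuthEquiv.acb_cab _ ((List.pairwise_cons.1 hsort).1 h (by simp)) (hhx.trans_lt hxy)

theorem rowWord_insert {T : Tableau} (h : ∀ R ∈ T, R.Pairwise (· ≤ ·)) (x : ℕ+) :
    KnuthEquiv (rowWord T ++ [x]) (rowWord (insert T x)) := by
  induction T generalizing x with
  | nil => exact KnuthEquiv.refl _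
  | cons R T ih =>
    cases hy : (rowInsert x R).2 with
    | none =>
      rw [insert_cons_none hy, rowInsert_of_none hy]
      simpa using KnuthEquiv.refl _
    | some y =>
      rw [insert_cons_some hy]
      have h₁ := (KnuthEquiv.rowInsert (h R (by simp)) hy).append_left (rowWord T)
      have h₂ := (ih (fun S hS => h S (by simp [hS])) y).append_right (rowInsert x R).1
      simp only [rowWord_cons, List.append_assoc, List.singleton_append] at h₁ h₂ ⊢
      exact h₁.trans h₂

theorem isSemistandard_P_and_equiv (w : Word) :
    IsSemistandard (P w) ∧ KnuthEquiv w (rowWord (P w)) := by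
  induction w using List.reverseRecOn with
  | nil => exact ⟨by simp [IsSemistandard, P], KnuthEquiv.refl _⟩
  | append_singleton w x ih =>
    have : P (w ++ [x]) = insert (P w) x := by simp [P]
    rw [this]
    exact ⟨ih.1.insert x, (ih.2.append_right [x]).trans (rowWord_insert ih.1.1 x)⟩

/-! ### The column reading word -/

theorem IsSemistandard.pairwise {T : Tableau} (h : IsSemistandard T) : T.Pairwise Dominates :=
  List.isChain_iff_pairwise.1 h.2

theorem IsSemistandard.column_pairwise {T : Tableau} (h : IsSemistandard T) (j : ℕ) :
    (column T j).Pairwise (· < ·) := by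
  refine List.Pairwise.filterMap (R := Dominates) _ ?_ h.pairwise
  intro R S hRS a ha b hb
  obtain ⟨a', ha', hab⟩ := hRS.getElem? hb
  simp_all

/-- `D` is the part of the first column already gathered from higher rows: in each row `c :: s`, the
tail `s` moves past `D`, and `c` then joins `D`. -/
theorem rowWord_append_column {T : Tableau} (h : ∀ R ∈ T, R.Pairwise (· ≤ ·)) {D : Word}
    (hD : ((column T 0).reverse ++ D).Pairwise (· > ·)) :
    KnuthEquiv (rowWord T ++ D) ((column T 0).reverse ++ (D ++ rowWord (T.map List.tail))) := by
  induction T generalizing D with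
  | nil => simpa [column] using KnuthEquiv.refl _
  | cons R T ih =>
    have hT : ∀ S ∈ T, S.Pairwise (· ≤ ·) := fun S hS => h S (by simp [hS])
    cases R with
    | nil => simpa [column] using ih hT (by simpa [column] using hD)
    | cons c s =>
      have hcol : column ((c :: s) :: T) 0 = c :: column T 0 := by simp [column]
      rw [hcol] at hD ⊢
      have hD' : ((column T 0).reverse ++ (c :: D)).Pairwise (· > ·) := by simpa using hD
      have h₁ := (KnuthEquiv.row_column (h _ List.mem_cons_self)
        (List.pairwise_append.1 hD').2.1).append_left (rowWord T)
      have h₂ := (ih hT hD').append_right s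
      simp only [rowWord_cons, List.map_cons, List.tail_cons, List.reverse_cons, List.append_assoc,
        List.cons_append, List.nil_append] at h₁ h₂ ⊢
      exact h₁.trans h₂

theorem column_map_tail (T : Tableau) (j : ℕ) : column (T.map List.tail) j = column T (j + 1) := by
  simp [column, List.filterMap_map]

/-- Splitting off the first column leaves the tails of the rows. Empty rows are harmless, and `n`
need only bound the row lengths because surplus columns are empty. -/
theorem rowWord_equiv_columns {T : Tableau} (h : ∀ R ∈ T, R.Pairwise (· ≤ ·))
    (hcol : ∀ j, (column T j).Pairwise (· < ·)) {n : ℕ} (hn : ∀ R ∈ T, R.length ≤ n) :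
    KnuthEquiv (rowWord T) ((List.range n).map fun j => (column T j).reverse).flatten := by
  induction n generalizing T with
  | zero =>
    have : rowWord T = [] := by
      simp only [rowWord, List.flatten_eq_nil_iff, List.mem_reverse]
      exact fun R hR => List.length_eq_zero_iff.1 (Nat.le_zero.1 (hn R hR))
    simpa [this] using KnuthEquiv.refl _
  | succ n ih =>
    have h₁ : KnuthEquiv (rowWord T) ((column T 0).reverse ++ rowWord (T.map List.tail)) := by
      simpa using rowWord_append_column h (D := [])
        (by simpa [List.pairwise_reverse] using hcol 0)
    have h₂ := ih (T := T.map List.tail)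
      (by simpa using fun R hR => (h R hR).sublist (List.tail_sublist R))
      (fun j => by simpa [column_map_tail] using hcol (j + 1))
      (by simpa using hn)
    rw [List.range_succ_eq_map]
    simpa [column_map_tail, Function.comp_def] using h₁.trans (h₂.append_left _)

theorem IsSemistandard.length_le {T : Tableau} (h : IsSemistandard T) {R : List ℕ+} (hR : R ∈ T) :
    R.length ≤ (T.headD []).length := by
  cases T with
  | nil => simp at hR
  | cons S T =>
    rcases List.mem_cons.1 hR with rfl | hR
    · simp
    · exact ((List.pairwise_cons.1 h.pairwise).1 R hR).length_le

theorem column_ne_nil {T : Tableau} {j : ℕ} (hj : j < (T.headD []).length) : column T j ≠ [] := by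
  cases T with
  | nil => simp at hj
  | cons R T =>
    have : R[j]? = some R[j] := List.getElem?_eq_getElem hj
    simp [column, this]

theorem rowWord_mem_centralizer {T : Tableau} (hT : IsSemistandard T)
    (h : ∀ C ∈ columns T, (C.length = 1 → IsSingletonColumn 2 C) ∧
      (2 ≤ C.length → (1 : ℕ+) ∈ C ∧ (2 : ℕ+) ∈ C)) :
    rowWord T ∈ centralizer [2, 1, 2] := by
  rw [mem_centralizer_congr
    (rowWord_equiv_columns hT.1 hT.column_pairwise fun R hR => hT.length_le hR)]
  refine flatten_mem_centralizer fun v hv => ?_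
  simp only [List.mem_map, List.mem_range] at hv
  obtain ⟨j, hj, rfl⟩ := hv
  obtain ⟨h₁, h₂⟩ := h (column T j) (List.mem_map.2 ⟨j, List.mem_range.2 hj, rfl⟩)
  have hpos := List.length_pos_iff.2 (column_ne_nil hj)
  rcases Nat.lt_or_ge (column T j).length 2 with hlen | hlen
  · rw [show column T j = [2] from h₁ (by omega)]
    -- One move suffices: `2122 ≡ 2212`.
    exact (KnuthEquiv.bac_bca [2] (by decide : (1 : ℕ+) < 2) le_rfl)
  · obtain ⟨m₁, m₂⟩ := h₂ hlen
    refine column_mem_centralizer ?_ (by simp [m₁, m₂])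
    simpa [List.pairwise_reverse] using hT.column_pairwise j

/-! ### Unmatched ones -/

/-- The number of letters `1` that are left when each `2` is cancelled against a later `1`. -/
def unmatched : Word → ℕ
  | [] => 0
  | x :: w => if x = 1 then unmatched w + 1 else if x = 2 then unmatched w - 1 else unmatched w

/-- The only moves that exchange a `1` and a `2` are `121 ↔ 211` and `212 ↔ 221`, and both preserve
the count. -/
theorem KnuthEquiv.unmatched_eq {v w : Word} (h : KnuthEquiv v w) :
    unmatched v = unmatched w := by
  refine KnuthEquiv.invariant unmatched ?_ ?_ ?_ h
  · intro x v w h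
    simp only [unmatched, h]
  · intro a b c y hab hbc
    simp only [unmatched, ← PNat.coe_inj, ← PNat.coe_le_coe, ← PNat.coe_lt_coe, PNat.val_ofNat]
      at *
    have := a.pos
    split_ifs <;> omega
  · intro a b c y hab hbc
    simp only [unmatched, ← PNat.coe_inj, ← PNat.coe_le_coe, ← PNat.coe_lt_coe, PNat.val_ofNat]
      at *
    have := a.pos
    split_ifs <;> omega

theorem unmatched_append (w : Word) {v : Word} (hv : unmatched v = 0) :
    unmatched (w ++ v) = unmatched w := by
  induction w with
  | nil => exact hv
  | cons x w ih => simp only [List.cons_append, unmatched, ih]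

/-- Appending `212` on the right changes nothing, whereas prefixing it sends a count `n` to the
truncated `n - 1`; so `n = n - 1`. -/
theorem unmatched_eq_zero {w : Word} (h : w ∈ centralizer [2, 1, 2]) : unmatched w = 0 := by
  have h' := KnuthEquiv.unmatched_eq h
  rw [unmatched_append w (by decide)] at h'
  simp [unmatched] at h'
  omega

theorem unmatched_append_of_three_le {U : Word} (hU : ∀ x ∈ U, 3 ≤ x) (v : Word) :
    unmatched (U ++ v) = unmatched v := by
  induction U with
  | nil => rfl
  | cons x U ih =>
    have hx := hU x (by simp)
    have h₁ : x ≠ 1 := by rintro rfl; exact absurd hx (by decide)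
    have h₂ : x ≠ 2 := by rintro rfl; exact absurd hx (by decide)
    simp [unmatched, h₁, h₂, ih fun y hy => hU y (by simp [hy])]

theorem unmatched_le_append (u v : Word) : unmatched v ≤ unmatched (u ++ v) + u.length := by
  induction u with
  | nil => simp
  | cons x u ih =>
    simp only [List.cons_append, unmatched, List.length_cons]
    split_ifs <;> omega

/-- In a weakly increasing row no `2` precedes a `1`, so nothing cancels, and the entries up to
position `j` are all `1`. -/
theorem lt_unmatched {R : List ℕ+} (hR : R.Pairwise (· ≤ ·)) {j : ℕ} (hj : R[j]? = some 1) :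
    j < unmatched R := by
  induction R generalizing j with
  | nil => simp at hj
  | cons r R ih =>
    have hR' := List.pairwise_cons.1 hR
    cases j with
    | zero =>
      obtain rfl : r = 1 := by simpa using hj
      simp [unmatched]
    | succ j =>
      have hj' : R[j]? = some 1 := by simpa using hj
      have hr : r = 1 := le_antisymm (hR'.1 1 (List.mem_of_getElem? hj')) one_le
      have := ih hR'.2 hj'
      simp [unmatched, hr]
      omega

/-! ### Unions of two increasing subsequences -/

/-- The largest number of letters of a word in two disjoint weakly increasing subsequences, the
first with letters at least `p` and the second with letters at least `q`. -/
def twoIncreasing : Word → ℕ+ → ℕ+ → ℕ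
  | [], _, _ => 0
  | x :: w, p, q => max (twoIncreasing w p q)
      (max (if p ≤ x then twoIncreasing w x q + 1 else 0)
        (if q ≤ x then twoIncreasing w p x + 1 else 0))

theorem twoIncreasing_symm (w : Word) (p q : ℕ+) : twoIncreasing w p q = twoIncreasing w q p := by
  induction w generalizing p q with
  | nil => rfl
  | cons x w ih =>
    simp only [twoIncreasing]
    rw [ih p q, ih x q, ih p x, max_comm (ite _ _ _)]

theorem twoIncreasing_anti_left (w : Word) {p p' : ℕ+} (h : p ≤ p') (q : ℕ+) :
    twoIncreasing w p' q ≤ twoIncreasing w p q := by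
  induction w generalizing p p' q with
  | nil => rfl
  | cons x w ih =>
    simp only [twoIncreasing]
    have h₁ := ih h q
    have h₂ := ih h x
    have : p' ≤ x → p ≤ x := h.trans
    split_ifs <;> first | omega | tauto

/-- Upper bounds turn the maximum into a conjunction; the offset `k` counts letters already chosen,
so that the rule can be used repeatedly by `simp`. -/
theorem twoIncreasing_cons_add_le {x p q : ℕ+} {w : Word} {k n : ℕ} :
    twoIncreasing (x :: w) p q + k ≤ n ↔ twoIncreasing w p q + k ≤ n ∧
      (p ≤ x → twoIncreasing w x q + (k + 1) ≤ n) ∧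
      (q ≤ x → twoIncreasing w p x + (k + 1) ≤ n) := by
  simp only [twoIncreasing]
  by_cases h₁ : p ≤ x <;> by_cases h₂ : q ≤ x <;> simp [h₁, h₂] <;> omega

theorem twoIncreasing_acb_cab {a b c : ℕ+} (y : Word) (hab : a ≤ b) (hbc : b < c) (p q : ℕ+) :
    twoIncreasing (a :: c :: b :: y) p q = twoIncreasing (c :: a :: b :: y) p q := by
  have hs := twoIncreasing_symm y
  have hab' := fun q => twoIncreasing_anti_left y hab q
  have hbc' := fun q => twoIncreasing_anti_left y hbc.le q
  have hac := hab.trans_lt hbc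
  refine eq_of_forall_ge_iff fun n => ?_
  rw [← Nat.add_zero (twoIncreasing (a :: _) p q), ← Nat.add_zero (twoIncreasing (c :: _) p q)]
  simp only [twoIncreasing_cons_add_le, hab, hac.le, hbc.not_ge, hac.not_ge,
    true_imp_iff, false_imp_iff, and_true, true_and]
  -- Only symmetry and antitonicity in the thresholds are needed of the remaining word.
  generalize twoIncreasing y = g at *
  constructor <;> intro h <;> refine ⟨?_, ?_, ?_⟩ <;> grind

theorem twoIncreasing_bac_bca {a b c : ℕ+} (y : Word) (hab : a < b) (hbc : b ≤ c) (p q : ℕ+) :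
    twoIncreasing (b :: a :: c :: y) p q = twoIncreasing (b :: c :: a :: y) p q := by
  have hs := twoIncreasing_symm y
  have hab' := fun q => twoIncreasing_anti_left y hab.le q
  have hbc' := fun q => twoIncreasing_anti_left y hbc q
  have hac := hab.trans_le hbc
  refine eq_of_forall_ge_iff fun n => ?_
  rw [← Nat.add_zero (twoIncreasing (b :: a :: _) p q),
    ← Nat.add_zero (twoIncreasing (b :: c :: _) p q)]
  simp only [twoIncreasing_cons_add_le, hbc, hac.le, hab.not_ge, hac.not_ge,
    true_imp_iff, false_imp_iff, and_true, true_and]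
  generalize twoIncreasing y = g at *
  constructor <;> intro h <;> refine ⟨?_, ?_, ?_⟩ <;> grind

/-- All thresholds are treated at once, since prefixing `x` may replace a threshold by `x`. -/
theorem KnuthEquiv.twoIncreasing_eq {v w : Word} (h : KnuthEquiv v w) :
    twoIncreasing v = twoIncreasing w := by
  refine KnuthEquiv.invariant twoIncreasing ?_ ?_ ?_ h
  · intro x v w h
    funext p q
    simp only [twoIncreasing, h]
  · intro a b c y hab hbc
    funext p q
    exact twoIncreasing_acb_cab y hab hbc p q
  · intro a b c y hab hbc
    funext p q
    exact twoIncreasing_bac_bca y hab hbc p q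

/-- One of the two increasing subsequences may be taken without letters `1`. -/
theorem twoIncreasing_one_one_le (w : Word) : twoIncreasing w 1 1 ≤ twoIncreasing w 2 1 := by
  -- Until one subsequence takes a letter `≥ 2`, all chosen ones can go to the other; after that the
  -- first takes no more ones.
  induction w with
  | nil => rfl
  | cons x w ih =>
    have hsymm := twoIncreasing_symm w 1 x
    by_cases hx : x = 1
    · subst hx
      simp [twoIncreasing]
      omega
    · have hx2 : (2 : ℕ+) ≤ x := by
        rw [← PNat.coe_le_coe, PNat.val_ofNat]
        rw [← PNat.coe_inj, PNat.one_coe] at hx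
        have := x.pos
        omega
      simp [twoIncreasing, hx2]
      omega

/-- Both letters `2` go to the first subsequence and the `1` to the second, leaving the thresholds
`2, 1` for `w`. -/
theorem twoIncreasing_add_three_le (w : Word) :
    twoIncreasing w 1 1 + 3 ≤ twoIncreasing ([2, 1, 2] ++ w) 1 1 := by
  have h₁ := twoIncreasing_one_one_le w
  have h₂ : twoIncreasing w 2 1 + 1 ≤ twoIncreasing (2 :: w) 2 1 := by
    simp [twoIncreasing]
  have h₃ : twoIncreasing (2 :: w) 2 1 + 1 ≤ twoIncreasing (1 :: 2 :: w) 2 1 := by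
    rw [twoIncreasing.eq_2 2 1 1]
    simp
  have h₄ : twoIncreasing (1 :: 2 :: w) 2 1 + 1 ≤ twoIncreasing (2 :: 1 :: 2 :: w) 1 1 := by
    rw [twoIncreasing.eq_2 1 1 2]
    simp
  simp only [List.cons_append, List.nil_append]
  omega

/-- A subsequence with threshold at least 3 gets nothing from `212`, and the other gets at most two
letters because `212` is not increasing. -/
theorem twoIncreasing_append_of_three_le (w : Word) {p : ℕ+} (hp : 3 ≤ p) (q : ℕ+) :
    twoIncreasing (w ++ [2, 1, 2]) p q ≤ twoIncreasing w p q + 2 := by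
  induction w generalizing p q with
  | nil =>
    have h₁ : ¬ p ≤ 1 := fun h => absurd (hp.trans h) (by decide)
    have h₂ : ¬ p ≤ 2 := fun h => absurd (hp.trans h) (by decide)
    have h₃ : ¬ (2 : ℕ+) ≤ 1 := by decide
    simp only [List.nil_append, twoIncreasing, h₁, h₂, h₃, if_false]
    split_ifs <;> omega
  | cons x w ih =>
    have h := (twoIncreasing_cons_add_le (x := x) (w := w) (p := p) (q := q) (k := 0)).1 le_rfl
    rw [← Nat.add_zero (twoIncreasing (x :: w ++ _) p q), List.cons_append,
      twoIncreasing_cons_add_le]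
    refine ⟨?_, fun hx => ?_, fun hx => ?_⟩
    · have := ih hp q
      omega
    · have := ih (hp.trans hx) q
      have := h.2.1 hx
      omega
    · have := ih hp x
      have := h.2.2 hx
      omega

/-- Either some chosen letter of `w` is `≥ 3`, and at most two letters are gained, or all chosen
letters of `w` are `≤ 2`. -/
theorem twoIncreasing_append_le (w : Word) (p q : ℕ+) :
    twoIncreasing (w ++ [2, 1, 2]) p q ≤
      max (twoIncreasing w p q + 2) (w.countP (· ≤ 2) + 3) := by
  induction w generalizing p q with
  | nil =>
    simp only [List.nil_append, twoIncreasing]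
    split_ifs <;> simp
  | cons x w ih =>
    have h₁ := ih p q
    have h₂ := ih x q
    have h₃ := ih p x
    simp only [List.cons_append, twoIncreasing, List.countP_cons, decide_eq_true_eq]
    by_cases hx : x ≤ 2
    · simp only [hx, if_true]
      split_ifs <;> omega
    · have hx3 : (3 : ℕ+) ≤ x := by
        rw [← PNat.coe_le_coe, PNat.val_ofNat] at *
        omega
      have h₄ := twoIncreasing_append_of_three_le w hx3 q
      have h₅ := twoIncreasing_append_of_three_le w hx3 p
      rw [twoIncreasing_symm, twoIncreasing_symm w] at h₅
      simp only [hx, if_false]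
      split_ifs <;> omega

theorem twoIncreasing_le_countP {w : Word} (h : w ∈ centralizer [2, 1, 2]) :
    twoIncreasing w 1 1 ≤ w.countP (· ≤ 2) := by
  have h₁ := congrFun (congrFun (KnuthEquiv.twoIncreasing_eq h) 1) 1
  have h₂ := twoIncreasing_add_three_le w
  have h₃ := twoIncreasing_append_le w 1 1
  omega

theorem twoIncreasing_le_append (u v : Word) (p q : ℕ+) :
    twoIncreasing v p q ≤ twoIncreasing (u ++ v) p q := by
  induction u with
  | nil => rfl
  | cons x u ih =>
    simp only [List.cons_append, twoIncreasing]
    omega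

theorem length_add_length_le_twoIncreasing {S R : List ℕ+} (hS : S.Pairwise (· ≤ ·))
    (hR : R.Pairwise (· ≤ ·)) {p q : ℕ+} (hp : ∀ x ∈ S, p ≤ x) (hq : ∀ x ∈ R, q ≤ x) :
    S.length + R.length ≤ twoIncreasing (S ++ R) p q := by
  induction S generalizing p with
  | nil =>
    induction R generalizing q with
    | nil => simp
    | cons r R ih =>
      have hR' := List.pairwise_cons.1 hR
      have := ih hR'.2 hR'.1
      have hr := hq r (by simp)
      simp only [List.nil_append, twoIncreasing, List.length_cons, hr, if_true] at this ⊢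
      omega
  | cons s S ih =>
    have hS' := List.pairwise_cons.1 hS
    have := ih hS'.2 hS'.1
    have hs := hp s (by simp)
    simp only [List.cons_append, twoIncreasing, List.length_cons, hs, if_true]
    omega

/-! ### The shape of a tableau in the centralizer -/

theorem columns_of_rowWord_mem_centralizer {T : Tableau} (hT : IsSemistandard T)
    (h : rowWord T ∈ centralizer [2, 1, 2]) :
    ∀ C ∈ columns T, (C.length = 1 → IsSingletonColumn 2 C) ∧
      (2 ≤ C.length → (1 : ℕ+) ∈ C ∧ (2 : ℕ+) ∈ C) := by
  intro C hC
  obtain ⟨j, hj, rfl⟩ := List.mem_map.1 hC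
  rw [List.mem_range] at hj
  cases T with
  | nil => simp at hj
  | cons R T =>
  replace hj : j < R.length := hj
  have hR : R.Pairwise (· ≤ ·) := hT.1 R (by simp)
  have hRj : R[j]? = some R[j] := List.getElem?_eq_getElem hj
  have hbal := unmatched_eq_zero h
  have htwo := twoIncreasing_le_countP h
  have hone : ∀ R : List ℕ+, ∀ x ∈ R, 1 ≤ x := fun _ _ _ => one_le
  cases T with
  | nil =>
    have hlen := length_add_length_le_twoIncreasing List.Pairwise.nil hR (hone []) (hone R)
    simp only [rowWord_cons, rowWord_nil, List.nil_append, List.length_nil, zero_add]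
      at hbal htwo hlen
    have hle : ∀ x ∈ R, x ≤ 2 := by
      simpa using List.countP_eq_length.1 (le_antisymm List.countP_le_length (hlen.trans htwo))
    have h2 : R[j] = 2 := by
      by_contra hne
      have h1 : R[j] = 1 := by
        have := hle R[j] (List.getElem_mem hj)
        have hpos := R[j].pos
        simp only [← PNat.coe_inj, ← PNat.coe_le_coe, PNat.val_ofNat] at *
        omega
      have := lt_unmatched hR (hRj.trans (congrArg some h1))
      omega
    simp [column, hRj, h2, IsSingletonColumn]
  | cons S U =>
    have hpair := List.pairwise_cons.1 hT.pairwise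
    have hRS : Dominates R S := hpair.1 S (by simp)
    have hSU := (List.pairwise_cons.1 hpair.2).1
    have hS : S.Pairwise (· ≤ ·) := hT.1 S (by simp)
    -- An entry of the third row or lower exceeds an entry of `S`, which exceeds an entry of `R`.
    have hU : ∀ x ∈ rowWord U, 3 ≤ x := by
      intro x hx
      obtain ⟨V, hV, hxV⟩ := List.mem_flatten.1 hx
      obtain ⟨y, hy, hyx⟩ := (hSU V (List.mem_reverse.1 hV)).exists_lt hxV
      obtain ⟨z, -, hzy⟩ := hRS.exists_lt hy
      have := z.pos
      simp only [← PNat.coe_lt_coe, ← PNat.coe_le_coe, PNat.val_ofNat] at *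
      omega
    have hlen := (length_add_length_le_twoIncreasing hS hR (hone S) (hone R)).trans
      (twoIncreasing_le_append (rowWord U) (S ++ R) 1 1)
    simp only [rowWord_cons, List.append_assoc] at hbal htwo
    rw [unmatched_append_of_three_le hU] at hbal
    have hcount : (rowWord U).countP (· ≤ 2) = 0 := by
      rw [List.countP_eq_zero]
      intro x hx hx2
      exact absurd ((hU x hx).trans (of_decide_eq_true hx2)) (by decide)
    rw [List.countP_append, hcount, zero_add] at htwo
    -- At least `S.length + R.length` letters of `S ++ R` are `≤ 2`, hence all of them.
    have hle : ∀ x ∈ S ++ R, x ≤ 2 := by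
      have := List.countP_eq_length.1 (le_antisymm List.countP_le_length
        (((List.length_append (as := S) (bs := R)).le.trans hlen).trans htwo))
      exact fun x hx => of_decide_eq_true (this x hx)
    cases hSj : S[j]? with
    | some b =>
      obtain ⟨a, ha, hab⟩ := hRS.getElem? hSj
      have hb2 := hle b (List.mem_append_left _ (List.mem_of_getElem? hSj))
      have hpos := a.pos
      have hb : b = 2 := by
        simp only [← PNat.coe_inj, ← PNat.coe_le_coe, ← PNat.coe_lt_coe, PNat.val_ofNat] at *
        omega
      have ha1 : a = 1 := by
        simp only [← PNat.coe_inj, ← PNat.coe_le_coe, ← PNat.coe_lt_coe, PNat.val_ofNat] at *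
        omega
      simp [column, ha, hSj, hb, ha1]
    | none =>
      have hSlen : S.length ≤ j := List.getElem?_eq_none_iff.1 hSj
      have hUj : U.filterMap (fun V => V[j]?) = [] := by
        rw [List.filterMap_eq_nil_iff]
        exact fun V hV => List.getElem?_eq_none_iff.2 ((hSU V hV).length_le.trans hSlen)
      have h2 : R[j] = 2 := by
        by_contra hne
        have h1 : R[j] = 1 := by
          have := hle R[j] (List.mem_append_right _ (List.getElem_mem hj))
          have hpos := R[j].pos
          simp only [← PNat.coe_inj, ← PNat.coe_le_coe, PNat.val_ofNat] at *
          omega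
        -- A `1` in position `j` gives more than `j ≥ S.length` unmatched ones in `R`, too many for
        -- the letters of `S` to cancel.
        have := lt_unmatched hR (hRj.trans (congrArg some h1))
        have := unmatched_le_append S R
        omega
      simp [column, hRj, hSj, hUj, h2, IsSingletonColumn]

end Plactic

theorem theoremC (w : Plactic.Word) :
    w ∈ Plactic.centralizer [2, 1, 2] ↔
      ∀ C ∈ Plactic.columns (Plactic.P w),
        (C.length = 1 → Plactic.IsSingletonColumn 2 C) ∧
        (2 ≤ C.length → (1 : ℕ+) ∈ C ∧ (2 : ℕ+) ∈ C) := by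
  obtain ⟨hT, hw⟩ := Plactic.isSemistandard_P_and_equiv w
  rw [Plactic.mem_centralizer_congr hw]
  exact ⟨Plactic.columns_of_rowWord_mem_centralizer hT, Plactic.rowWord_mem_centralizer hT⟩
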